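/- Let $M$ be a finite-dimensional smooth manifold (not necessarily compact) with a hypercomplex structure $(I,J,K)$, that is, $I,J,K$ are smooth endomorphism fields of the tangent bundle $TM$ with $I^2=J^2=K^2=-1$, $IJ=-JI=K$, each of which is an integrable complex structure (its Nijenhuis tensor vanishes). Let $g$ be a Kähler metric on $(M,I)$, that is, a smooth Riemannian metric with $g(I\cdot,I\cdot)=g$ whose fundamental form $g(I\cdot,\cdot)$ is closed. Then $(M,I,J,K)$ admits an HKT-metric $g_1$: a smooth Riemannian metric with $$g_1(Ix,Iy)=g_1(Jx,Jy)=g_1(Kx,Ky)=g_1(x,y)\qquad\text{for all }x,y\in T_mM,\ m\in M,$$ for which the $(2,0)$-form $\Omega=g_1(J\cdot,\cdot)+\sqrt{-1}\,g_1(K\cdot,\cdot)$ on $(M,I)$ satisfies $\partial\Omega=0$, where $\partial:\Lambda^{2,0}_I(M)\to\Lambda^{3,0}_I(M)$ is the Dolbeault differential of $(M,I)$, i.e. the $(3,0)$-part of the exterior derivative. Moreover, $g_1$ can be obtained by averaging $g$ over the $SU(2)$-action on $TM$ given by the unit quaternions: with $q=a+bi+cj+dk$ acting on tangent vectors by $a+bI+cJ+dK$,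 one can take $$g_1(x,y)=\int_{SU(2)} g(qx,qy)\,dq ,$$ where $dq$ is the Haar probability measure on $SU(2)$. -/

import Mathlib

open scoped Manifold ContDiff Quaternion
open Bundle

namespace HKT

noncomputable section

/-! ### Alternating forms on a real vector space -/

section LinearAlgebra

/-- The alternating `2`-form `(v₀, v₁) ↦ B v₀ v₁` attached to a continuous bilinear form `B`
which vanishes on the diagonal. -/
def twoForm {V : Type*} [NormedAddCommGroup V] [NormedSpace ℝ V]
    (B : V →L[ℝ] V →L[ℝ] ℝ) (hB : ∀ v, B v v = 0) : V [⋀^Fin 2]→L[ℝ] ℝ where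
  toFun v := B (v 0) (v 1)
  map_update_add' := by
    intro _ v i x y
    fin_cases i <;> simp [Function.update]
  map_update_smul' := by
    intro _ v i c x
    fin_cases i <;> simp [Function.update]
  cont := by
    change Continuous fun v : Fin 2 → V ↦ B (v 0) (v 1)
    fun_prop
  map_eq_zero_of_eq' := by
    intro v i j hij hne
    have h : v 0 = v 1 := by
      fin_cases i <;> fin_cases j <;> simp_all
    change B (v 0) (v 1) = 0
    rw [h, hB]

variable {V : Type*} [AddCommGroup V] [Module ℝ V] [TopologicalSpace V]

/-- Apply `A` to the entries of `v` whose index lies in `S`, and leave the others unchanged. -/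
def applyOn {k : ℕ} (A : V →L[ℝ] V) (S : Finset (Fin k)) (v : Fin k → V) : Fin k → V :=
  fun j ↦ if j ∈ S then A (v j) else v j

theorem applyOn_update {k : ℕ} (A : V →L[ℝ] V) (S : Finset (Fin k)) (v : Fin k → V)
    (i : Fin k) (x : V) :
    applyOn A S (Function.update v i x) =
      Function.update (applyOn A S v) i (if i ∈ S then A x else x) := by
  ext j
  by_cases h : j = i
  · subst h; simp [applyOn]
  · simp [applyOn, h]

/-- The component of type `(k, 0)`, with respect to a complex structure `A` on the real vector
space `V`, of a complex-valued `k`-form `α`: it is obtained by extending `α` complex-multilinearly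
to the complexification of `V` and by inserting in every slot the projection
`v ↦ (v - √-1 A v) / 2` of `V` to the space `V^{1,0}` of vectors of type `(1,0)`. After expanding,
this is `2⁻ᵏ ∑_S (-√-1)^|S| α(…, A v_j (j ∈ S), …, v_j (j ∉ S), …)`. -/
def holPart {k : ℕ} (A : V →L[ℝ] V) (α : V [⋀^Fin k]→L[ℝ] ℂ) : V [⋀^Fin k]→L[ℝ] ℂ where
  toFun v := (1 / 2 : ℂ) ^ k * ∑ S : Finset (Fin k), (-Complex.I) ^ S.card * α (applyOn A S v)
  map_update_add' := by
    intro inst v i x y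
    obtain rfl : inst = instDecidableEqFin k := Subsingleton.elim _ _
    rw [← mul_add, ← Finset.sum_add_distrib]
    congr 1
    refine Finset.sum_congr rfl fun S _ ↦ ?_
    rw [applyOn_update, applyOn_update, applyOn_update, ← mul_add]
    congr 1
    split_ifs
    · rw [map_add]
      exact α.map_update_add _ _ _ _
    · exact α.map_update_add _ _ _ _
  map_update_smul' := by
    intro inst v i c x
    obtain rfl : inst = instDecidableEqFin k := Subsingleton.elim _ _
    rw [Complex.real_smul, mul_left_comm]
    congr 1
    rw [Finset.mul_sum]
    refine Finset.sum_congr rfl fun S _ ↦ ?_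
    rw [applyOn_update, applyOn_update, mul_left_comm]
    congr 1
    rw [← Complex.real_smul]
    split_ifs
    · rw [map_smul]
      exact α.map_update_smul _ _ _ _
    · exact α.map_update_smul _ _ _ _
  cont := by
    change Continuous fun v : Fin k → V ↦
      (1 / 2 : ℂ) ^ k * ∑ S : Finset (Fin k), (-Complex.I) ^ S.card * α (applyOn A S v)
    refine continuous_const.mul (continuous_finsetSum _ fun S _ ↦ continuous_const.mul ?_)
    refine α.cont.comp (continuous_pi fun j ↦ ?_)
    by_cases h : j ∈ S
    · simpa [applyOn, h] using A.continuous.comp' (continuous_apply j)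
    · simpa [applyOn, h] using continuous_apply j
  map_eq_zero_of_eq' := by
    intro v i j hij hne
    change (1 / 2 : ℂ) ^ k * ∑ S : Finset (Fin k), (-Complex.I) ^ S.card * α (applyOn A S v) = 0
    have hv : ∀ l, v (Equiv.swap i j l) = v l := by
      intro l
      rcases eq_or_ne l i with rfl | hi
      · simp [hij]
      rcases eq_or_ne l j with rfl | hj
      · simp [hij]
      rw [Equiv.swap_apply_of_ne_of_ne hi hj]
    have key : ∑ S : Finset (Fin k), (-Complex.I) ^ S.card * α (applyOn A S v) =
        -∑ S : Finset (Fin k), (-Complex.I) ^ S.card * α (applyOn A S v) := by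
      conv_lhs => rw [← Equiv.sum_comp (Equiv.finsetCongr (Equiv.swap i j))]
      rw [← Finset.sum_neg_distrib]
      refine Finset.sum_congr rfl fun S _ ↦ ?_
      have h1 : applyOn A (Equiv.finsetCongr (Equiv.swap i j) S) v =
          applyOn A S v ∘ Equiv.swap i j := by
        ext l
        simp [applyOn, hv]
      have h2 : α (applyOn A S v ∘ Equiv.swap i j) = -α (applyOn A S v) :=
        α.toAlternatingMap.map_swap _ hne
      rw [h1, h2]
      simp
    rw [self_eq_neg.mp key, mul_zero]

end LinearAlgebra

/-! ### Differential forms on a manifold -/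

section Manifold

variable {E : Type*} [NormedAddCommGroup E] [NormedSpace ℝ E]
  {M : Type*} [TopologicalSpace M] [ChartedSpace E M]

/-- The exterior derivative, at the point `x`, of a differential `k`-form `η` on the manifold `M`:
the form is read in the chart at `x`, differentiated there, and pulled back to `M`. -/
def extDer {F : Type*} [NormedAddCommGroup F] [NormedSpace ℝ F] {k : ℕ}
    (η : Π x : M, TangentSpace 𝓘(ℝ, E) x [⋀^Fin k]→L[ℝ] F) (x : M) :
    TangentSpace 𝓘(ℝ, E) x [⋀^Fin (k + 1)]→L[ℝ] F :=
  (extDeriv (fun e : E ↦ ((η ((extChartAt 𝓘(ℝ, E) x).symm e)).compContinuousLinearMap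
      (mfderiv 𝓘(ℝ, E) 𝓘(ℝ, E) (extChartAt 𝓘(ℝ, E) x).symm e) : E [⋀^Fin k]→L[ℝ] F))
    (extChartAt 𝓘(ℝ, E) x x)).compContinuousLinearMap
      (mfderiv 𝓘(ℝ, E) 𝓘(ℝ, E) (extChartAt 𝓘(ℝ, E) x) x)

variable [IsManifold 𝓘(ℝ, E) ∞ M]

variable (E M) in
/-- Smooth Riemannian metrics on `M`. -/
abbrev RiemMetric := ContMDiffRiemannianMetric 𝓘(ℝ, E) ∞ E (fun x : M ↦ TangentSpace 𝓘(ℝ, E) x)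

variable (E M) in
/-- An integrable complex structure on `M`: a smooth field `J` of endomorphisms of the tangent
bundle with `J² = -1` whose Nijenhuis tensor
`N(X, Y) = [JX, JY] - J[JX, Y] - J[X, JY] - [X, Y]` vanishes, for all vector fields `X`, `Y` which
are smooth near the point under consideration. -/
structure ComplexStructure where
  toFun (x : M) : TangentSpace 𝓘(ℝ, E) x →L[ℝ] TangentSpace 𝓘(ℝ, E) x
  smooth : ContMDiff 𝓘(ℝ, E) (𝓘(ℝ, E).prod 𝓘(ℝ, E →L[ℝ] E)) ∞
    (fun x ↦ TotalSpace.mk' (E →L[ℝ] E)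
      (E := fun x : M ↦ TangentSpace 𝓘(ℝ, E) x →L[ℝ] TangentSpace 𝓘(ℝ, E) x) x (toFun x))
  sq_eq_neg (x : M) (v : TangentSpace 𝓘(ℝ, E) x) : toFun x (toFun x v) = -v
  integrable (X Y : Π x : M, TangentSpace 𝓘(ℝ, E) x) (x : M)
    (hX : ContMDiffAt 𝓘(ℝ, E) 𝓘(ℝ, E).tangent ∞ (fun y ↦ (⟨y, X y⟩ : TangentBundle 𝓘(ℝ, E) M)) x)
    (hY : ContMDiffAt 𝓘(ℝ, E) 𝓘(ℝ, E).tangent ∞ (fun y ↦ (⟨y, Y y⟩ : TangentBundle 𝓘(ℝ, E) M)) x) :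
    VectorField.mlieBracket 𝓘(ℝ, E) (fun y ↦ toFun y (X y)) (fun y ↦ toFun y (Y y)) x
      - toFun x (VectorField.mlieBracket 𝓘(ℝ, E) (fun y ↦ toFun y (X y)) Y x)
      - toFun x (VectorField.mlieBracket 𝓘(ℝ, E) X (fun y ↦ toFun y (Y y)) x)
      - VectorField.mlieBracket 𝓘(ℝ, E) X Y x = 0

namespace ComplexStructure

variable (J : ComplexStructure E M)

/-- The metric `g` is Hermitian on `(M, J)`: `g(Jv, Jw) = g(v, w)`. -/
def IsHermitian (g : RiemMetric E M) : Prop :=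
  ∀ (x : M) (v w : TangentSpace 𝓘(ℝ, E) x), g.inner x (J.toFun x v) (J.toFun x w) = g.inner x v w

theorem inner_self_eq_zero {J : ComplexStructure E M} {g : RiemMetric E M} (hg : J.IsHermitian g)
    (x : M) (v : TangentSpace 𝓘(ℝ, E) x) : g.inner x (J.toFun x v) v = 0 := by
  have h := hg x v (J.toFun x v)
  rw [J.sq_eq_neg, map_neg, g.symm x v] at h
  exact self_eq_neg.mp h.symm

/-- The fundamental form `ω_J(v, w) = g(Jv, w)` of a Hermitian metric on `(M, J)`. -/
def fundamentalForm {g : RiemMetric E M} (hg : J.IsHermitian g) (x : M) :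
    TangentSpace 𝓘(ℝ, E) x [⋀^Fin 2]→L[ℝ] ℝ :=
  twoForm (V := E) ((g.inner x).comp (J.toFun x)) (inner_self_eq_zero hg x)

/-- The metric `g` is Kähler on `(M, J)`: it is Hermitian and its fundamental form is closed. -/
structure IsKahler (g : RiemMetric E M) : Prop where
  hermitian : J.IsHermitian g
  closed : ∀ x, extDer (J.fundamentalForm hermitian) x = 0

/-- The Dolbeault differential `∂ : Λ^{p,0} → Λ^{p+1,0}` of the complex manifold `(M, J)`, that is,
the `(p+1, 0)`-part of the exterior derivative. -/
def del {p : ℕ} (Ω : Π x : M, TangentSpace 𝓘(ℝ, E) x [⋀^Fin p]→L[ℝ] ℂ) (x : M) :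
    TangentSpace 𝓘(ℝ, E) x [⋀^Fin (p + 1)]→L[ℝ] ℂ :=
  holPart (J.toFun x) (extDer Ω x)

end ComplexStructure

variable (E M) in
/-- A hypercomplex structure on `M`: three integrable complex structures with the quaternionic
relations `IJ = K = -JI`. -/
structure HypercomplexStructure where
  I : ComplexStructure E M
  J : ComplexStructure E M
  K : ComplexStructure E M
  I_J (x : M) (v : TangentSpace 𝓘(ℝ, E) x) : I.toFun x (J.toFun x v) = K.toFun x v
  J_I (x : M) (v : TangentSpace 𝓘(ℝ, E) x) : J.toFun x (I.toFun x v) = -K.toFun x v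

/-- The group `SU(2)`, realised as the group of unit quaternions. -/
abbrev SU2 : Type := Metric.sphere (0 : ℍ[ℝ]) 1

instance : MeasurableSpace SU2 := borel SU2

instance : BorelSpace SU2 := ⟨rfl⟩

/-- The Haar probability measure on `SU(2)`. -/
def haarSU2 : MeasureTheory.Measure SU2 := MeasureTheory.Measure.haarMeasure ⊤

namespace HypercomplexStructure

variable (h : HypercomplexStructure E M)

/-- The action of the quaternion `q = a + b i + c j + d k` on a tangent vector `v`, namely
`a v + b I v + c J v + d K v`. -/
def act (q : ℍ[ℝ]) {x : M} (v : TangentSpace 𝓘(ℝ, E) x) : TangentSpace 𝓘(ℝ, E) x :=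
  q.re • v + q.imI • h.I.toFun x v + q.imJ • h.J.toFun x v + q.imK • h.K.toFun x v

/-- Quaternionic Hermitian metrics: `g(Iv, Iw) = g(Jv, Jw) = g(Kv, Kw) = g(v, w)`. -/
structure IsQuaternionicHermitian (g : RiemMetric E M) : Prop where
  I : h.I.IsHermitian g
  J : h.J.IsHermitian g
  K : h.K.IsHermitian g

/-- The complex-valued form `Ω = ω_J + √-1 ω_K`, where `ω_J = g(J·, ·)` and `ω_K = g(K·, ·)`. -/
def hktForm {g : RiemMetric E M} (hg : h.IsQuaternionicHermitian g) (x : M) :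
    TangentSpace 𝓘(ℝ, E) x [⋀^Fin 2]→L[ℝ] ℂ :=
  Complex.ofRealCLM.compContinuousAlternatingMap (h.J.fundamentalForm hg.J x) +
    Complex.I • Complex.ofRealCLM.compContinuousAlternatingMap (h.K.fundamentalForm hg.K x)

/-- HKT-metrics: quaternionic Hermitian metrics such that `∂Ω = 0`, where `∂` is the Dolbeault
differential of `(M, I)`. -/
structure IsHKT (g : RiemMetric E M) : Prop where
  quaternionicHermitian : h.IsQuaternionicHermitian g
  del_eq_zero : ∀ x, h.I.del (h.hktForm quaternionicHermitian) x = 0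

/-- The metric `g₁` is the average of the metric `g` over the action of `SU(2)` on the tangent
bundle: `g₁(v, w) = ∫_{SU(2)} g(qv, qw) dq`, for the Haar probability measure `dq`. -/
def IsAverage (g₁ g : RiemMetric E M) : Prop :=
  ∀ (x : M) (v w : TangentSpace 𝓘(ℝ, E) x),
    g₁.inner x v w = ∫ q : SU2, g.inner x (h.act (q : ℍ[ℝ]) v) (h.act (q : ℍ[ℝ]) w) ∂haarSU2

end HypercomplexStructure

end Manifold

end

end HKT

/-!
The average of `g` over `SU(2)` only involves the second moments of the coordinates of a unit
quaternion, which are `1/4` on the diagonal and `0` off it (`integral_quatCoord_mul`). So it is the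
mean of `g`, `g(I·, I·)`, `g(J·, J·)` and `g(K·, K·)`, and since `g` is `I`-Hermitian this is
`g₁ = (g + g(J·, J·)) / 2` (`averagedMetric`), which is visibly smooth and quaternionic Hermitian.

Let `ω = g(I·, ·)`, a closed form of type `(1,1)` on `(M, I)`, and write `A·ω` for
`ω(A·, ·) + ω(·, A·)`. Then the fundamental forms of `g₁` with respect to `J` and `K` are
`-(IJ)·ω / 2` and `J·ω / 2`, so that `Ω = (-(IJ)·ω + √-1 J·ω) / 2`, and it has to be shown that
`dΩ` has no `(3,0)`-part. This is a pointwise identity in the first derivatives of `I`, `J` and `ω`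
in a chart:

* closedness of `ω` turns the exterior derivative of `A·ω` into terms `ω((D_x A) y - (D_y A) x, z)`
  minus derivatives of `ω` in the directions `A x`, `A y`, `A z` (`IsKahlerJet.dTwistJet_eq`);
* in the `(3,0)`-part, the derivatives of `ω` are taken in two slots of the same type, and
  differentiating the fact that `ω` is of type `(1,1)` replaces them by derivatives of `I`
  (`IsKahlerJet.derivative_terms`);
* what remains is `ω` applied to a vector that vanishes because the Nijenhuis tensors of `I` and `J`
  do (`IsHypercomplexJet.torsion_identity`).

These are assembled in `IsKahlerJet.dTwistJet_identity`. The argument works with real vectors: the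
imaginary part of the `(3,0)`-part is minus the real part with `I` applied to one slot
(`holPart_eq_zero_of_re`). The rest of the proof relates the tensor fields on `M`, their Lie
brackets and exterior derivatives to their expressions in a chart.
-/

namespace HKT

open Filter Topology MeasureTheory VectorField

/-! ### First-order linear algebra at a point -/

noncomputable section

variable {V : Type*} [NormedAddCommGroup V] [NormedSpace ℝ V]

/-- The Nijenhuis tensor, on constant vector fields `x`, `y`, of a field of endomorphisms of a
vector space whose value and derivative at a point are `A` and `dA`. -/
def nijenhuisJet (A : V →L[ℝ] V) (dA : V →L[ℝ] V →L[ℝ] V) (x y : V) : V :=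
  dA (A x) y - dA (A y) x + A (dA y x) - A (dA x y)

/-- The value and the first derivative at a point, in a chart, of a pair of anticommuting integrable
complex structures. The conditions on the derivatives `dI`, `dJ` are the derivatives of `I² = -1`,
`J² = -1`, `JI = -IJ`, and the vanishing of the Nijenhuis tensors. -/
structure IsHypercomplexJet (I J : V →L[ℝ] V) (dI dJ : V →L[ℝ] V →L[ℝ] V) : Prop where
  I_I (x : V) : I (I x) = -x
  J_J (x : V) : J (J x) = -x
  J_I (x : V) : J (I x) = -I (J x)
  dI_I (v x : V) : dI v (I x) = -I (dI v x)
  dJ_J (v x : V) : dJ v (J x) = -J (dJ v x)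
  dJ_I (v x : V) : dJ v (I x) = -dI v (J x) - I (dJ v x) - J (dI v x)
  nijenhuis_I (x y : V) : nijenhuisJet I dI x y = 0
  nijenhuis_J (x y : V) : nijenhuisJet J dJ x y = 0

/-- The value and the first derivative at a point, in a chart, of a closed `2`-form which is
invariant under the complex structure with value `I` and derivative `dI`. They are encoded as plain
functions `σ x y` and `dσ v x y` (the derivative in the direction `v`), with only the linearity that
the argument uses. -/
structure IsKahlerJet (I : V →L[ℝ] V) (dI : V →L[ℝ] V →L[ℝ] V) (σ : V → V → ℝ)
    (dσ : V → V → V → ℝ) : Prop where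
  add_left (x x' y : V) : σ (x + x') y = σ x y + σ x' y
  smul_left (c : ℝ) (x y : V) : σ (c • x) y = c * σ x y
  d_neg (v x y : V) : dσ (-v) x y = -dσ v x y
  d_neg_right (v x y : V) : dσ v x (-y) = -dσ v x y
  antisymm (x y : V) : σ x y = -σ y x
  d_antisymm (v x y : V) : dσ v x y = -dσ v y x
  apply_I (x y : V) : σ (I x) y = -σ x (I y)
  d_apply_I (v x y : V) : dσ v (I x) y + σ (dI v x) y = -dσ v x (I y) - σ x (dI v y)
  closed (x y z : V) : dσ x y z + dσ y z x + dσ z x y = 0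

/-- The antisymmetrized derivative `(x, y) ↦ (D_x A) y - (D_y A) x` of a field of endomorphisms. -/
def torsionJet (dA : V →L[ℝ] V →L[ℝ] V) (x y : V) : V := dA x y - dA y x

/-- The derivative of the `2`-form `(y, z) ↦ σ (A y) z + σ y (A z)` in the direction `x`. -/
def twistJet (σ : V → V → ℝ) (dσ : V → V → V → ℝ) (A : V →L[ℝ] V)
    (dA : V →L[ℝ] V →L[ℝ] V) (x y z : V) : ℝ :=
  dσ x (A y) z + σ (dA x y) z + (dσ x y (A z) + σ y (dA x z))

/-- The exterior derivative of the `2`-form `(y, z) ↦ σ (A y) z + σ y (A z)`. -/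
def dTwistJet (σ : V → V → ℝ) (dσ : V → V → V → ℝ) (A : V →L[ℝ] V)
    (dA : V →L[ℝ] V →L[ℝ] V) (x y z : V) : ℝ :=
  twistJet σ dσ A dA x y z - twistJet σ dσ A dA y x z + twistJet σ dσ A dA z x y

variable {I J : V →L[ℝ] V} {dI dJ dK : V →L[ℝ] V →L[ℝ] V}

/-- Only here does integrability enter. Over `ℂ`, for `x` and `y` of type `(1,0)` with respect to
`I`, this says that the `(0,1)`-part of `(D_x J) y - (D_y J) x` is
`√-1/2 ((D_{Jx} I) y - (D_{Jy} I) x)`. -/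
theorem IsHypercomplexJet.torsion_identity (h : IsHypercomplexJet I J dI dJ)
    (hK : ∀ v x, dK v x = dI v (J x) + I (dJ v x)) (x y : V) :
    torsionJet dK (I x) (I y) - torsionJet dK x y
      - I (torsionJet dK (I x) y) - I (torsionJet dK x (I y))
      + torsionJet dJ (I x) y + torsionJet dJ x (I y)
      - I (torsionJet dJ x y) + I (torsionJet dJ (I x) (I y))
      + (2 : ℝ) • ((dI (J x) y - I (dI (I (J x)) y)) - (dI (J y) x - I (dI (I (J y)) x))) = 0 := by
  -- Up to a factor, the first four terms represent the `(0,1)`-part of the Nijenhuis tensor of `J`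
  -- on the `(1,0)`-part of `x` and the `(0,1)`-vector obtained by applying `J` to that of `y`.
  have e : (2 : ℝ) • (nijenhuisJet J dJ x (I (J y)) - nijenhuisJet J dJ (I x) (J y)
      + I (nijenhuisJet J dJ x (J y)) + I (nijenhuisJet J dJ (I x) (I (J y)))
      - J (nijenhuisJet I dI (J x) (I (J y)))) = 0 := by
    simp only [h.nijenhuis_I, h.nijenhuis_J, map_zero, sub_zero, add_zero, smul_zero]
  rw [← e]
  simp only [nijenhuisJet, torsionJet, hK, map_add, map_sub, map_neg, h.I_I, h.J_J, h.J_I, h.dI_I,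
    h.dJ_J, h.dJ_I, _root_.neg_apply, neg_neg]
  module

variable {σ : V → V → ℝ} {dσ : V → V → V → ℝ}

theorem IsKahlerJet.neg_left (hσ : IsKahlerJet I dI σ dσ) (x y : V) : σ (-x) y = -σ x y := by
  rw [← neg_one_smul ℝ, hσ.smul_left, neg_one_mul]

theorem IsKahlerJet.neg_right (hσ : IsKahlerJet I dI σ dσ) (x y : V) : σ x (-y) = -σ x y := by
  rw [hσ.antisymm, hσ.neg_left, ← hσ.antisymm, hσ.antisymm]

theorem IsKahlerJet.sub_left (hσ : IsKahlerJet I dI σ dσ) (x x' y : V) :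
    σ (x - x') y = σ x y - σ x' y := by
  rw [sub_eq_add_neg, hσ.add_left, hσ.neg_left, sub_eq_add_neg]

theorem IsKahlerJet.dTwistJet_neg (hσ : IsKahlerJet I dI σ dσ) (A : V →L[ℝ] V)
    (dA : V →L[ℝ] V →L[ℝ] V) (x y z : V) :
    dTwistJet σ dσ A dA (-x) y z = -dTwistJet σ dσ A dA x y z := by
  have h : ∀ v x y, dσ v (-x) y = -dσ v x y := fun v x y ↦ by
    rw [hσ.d_antisymm, hσ.d_neg_right, ← hσ.d_antisymm, hσ.d_antisymm]
  simp only [dTwistJet, twistJet, map_neg, _root_.neg_apply, hσ.neg_left, hσ.neg_right, hσ.d_neg, h]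
  ring

/-- Closedness of `σ` on `(A x, y, z)`, `(x, A y, z)` and `(x, y, A z)` trades the derivatives of
`σ` in the directions `x`, `y`, `z` for derivatives in the directions `A x`, `A y`, `A z`. -/
theorem IsKahlerJet.dTwistJet_eq (hσ : IsKahlerJet I dI σ dσ) (A : V →L[ℝ] V)
    (dA : V →L[ℝ] V →L[ℝ] V) (x y z : V) :
    dTwistJet σ dσ A dA x y z =
      σ (torsionJet dA x y) z + σ (torsionJet dA y z) x + σ (torsionJet dA z x) y
        - (dσ (A x) y z + dσ (A y) z x + dσ (A z) x y) := by
  simp only [dTwistJet, twistJet, torsionJet, hσ.sub_left]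
  linear_combination hσ.closed (A x) y z + hσ.closed x (A y) z + hσ.closed x y (A z)
    - hσ.d_antisymm y (A x) z - hσ.d_antisymm y x (A z)
    + hσ.antisymm y (dA x z) - hσ.antisymm x (dA y z) + hσ.antisymm x (dA z y)

/-- The terms in which `σ` is differentiated. Since `σ` is of type `(1,1)`, its derivative is so up
to a term involving the derivative of `I`. -/
theorem IsKahlerJet.derivative_terms (h : IsHypercomplexJet I J dI dJ)
    (hσ : IsKahlerJet I dI σ dσ) (x y z : V) :
    dσ (I (J x)) y z - dσ (I (J (I x))) (I y) z - dσ (I (J (I x))) y (I z)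
      - dσ (I (J x)) (I y) (I z) - dσ (J (I x)) y z - dσ (J x) (I y) z - dσ (J x) y (I z)
      + dσ (J (I x)) (I y) (I z) =
    2 * σ (dI (J x) y - I (dI (I (J x)) y)) z - 2 * σ (dI (J x) z - I (dI (I (J x)) z)) y := by
  have h5 : I (J (I x)) = J x := by rw [h.J_I, map_neg, h.I_I, neg_neg]
  have h6 : ∀ y z, dσ (J (I x)) y z = -dσ (I (J x)) y z := fun y z ↦ by
    rw [h.J_I, hσ.d_neg]
  rw [h5, h6, h6]
  simp only [hσ.sub_left, hσ.apply_I]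
  have h1 := hσ.d_apply_I (J x) y z
  have h2 := hσ.d_apply_I (I (J x)) y (I z)
  have h3 := hσ.antisymm y (dI (J x) z)
  have h4 := hσ.antisymm y (dI (I (J x)) (I z))
  simp only [h.I_I, h.dI_I, hσ.neg_left, hσ.neg_right, hσ.d_neg_right,
    hσ.apply_I] at h1 h2 h3 h4
  linear_combination -2 * h1 - 2 * h2 + 2 * h3 + 2 * h4

/-- The real part of the identity `(dΩ)^{3,0} = 0` (multiplied by `16`), for
`Ω = (-K·σ + √-1 J·σ) / 2`. -/
theorem IsKahlerJet.dTwistJet_identity (h : IsHypercomplexJet I J dI dJ)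
    (hσ : IsKahlerJet I dI σ dσ) (hK : ∀ v x, dK v x = dI v (J x) + I (dJ v x)) (x y z : V) :
    -(dTwistJet σ dσ (I ∘L J) dK x y z - dTwistJet σ dσ (I ∘L J) dK (I x) (I y) z
      - dTwistJet σ dσ (I ∘L J) dK (I x) y (I z) - dTwistJet σ dσ (I ∘L J) dK x (I y) (I z))
    + (dTwistJet σ dσ J dJ (I x) y z + dTwistJet σ dσ J dJ x (I y) z
      + dTwistJet σ dσ J dJ x y (I z) - dTwistJet σ dσ J dJ (I x) (I y) (I z)) = 0 := by
  have t : ∀ x y z, σ (torsionJet dK (I x) (I y) - torsionJet dK x y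
      - I (torsionJet dK (I x) y) - I (torsionJet dK x (I y))
      + torsionJet dJ (I x) y + torsionJet dJ x (I y)
      - I (torsionJet dJ x y) + I (torsionJet dJ (I x) (I y))
      + (2 : ℝ) • ((dI (J x) y - I (dI (I (J x)) y))
        - (dI (J y) x - I (dI (I (J y)) x)))) z = 0 := fun x y z ↦ by
    rw [h.torsion_identity hK, ← zero_smul ℝ (0 : V), hσ.smul_left, zero_mul]
  have t1 := t x y z
  have t2 := t y z x
  have t3 := t z x y
  have d1 := hσ.derivative_terms h x y z
  have d2 := hσ.derivative_terms h y z x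
  have d3 := hσ.derivative_terms h z x y
  simp only [hσ.dTwistJet_eq, ContinuousLinearMap.comp_apply]
  simp only [hσ.add_left, hσ.sub_left,
    hσ.smul_left, hσ.apply_I] at t1 t2 t3 d1 d2 d3
  linear_combination t1 + t2 + t3 + d1 + d2 + d3

end

/-! ### Second moments of the Haar measure on `SU(2)` -/

instance : CompactSpace SU2 := Metric.sphere.compactSpace _ _

instance : haarSU2.IsHaarMeasure := by unfold haarSU2; infer_instance

instance : IsProbabilityMeasure haarSU2 := ⟨by
  simpa [haarSU2] using
    Measure.haarMeasure_self (K₀ := (⊤ : TopologicalSpace.PositiveCompacts SU2))⟩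

/-- The real coordinates `a, b, c, d` of the quaternion `a + b i + c j + d k`. -/
def quatCoord (a : Fin 4) (q : ℍ[ℝ]) : ℝ := ![q.re, q.imI, q.imJ, q.imK] a

theorem continuous_quatCoord (a : Fin 4) : Continuous (quatCoord a) := by
  fin_cases a
  · exact Quaternion.continuous_re
  · exact Quaternion.continuous_imI
  · exact Quaternion.continuous_imJ
  · exact Quaternion.continuous_imK

theorem integrable_quatCoord_mul (a b : Fin 4) :
    Integrable (fun q : SU2 ↦ quatCoord a q * quatCoord b q) haarSU2 := by
  refine Continuous.integrable_of_hasCompactSupport ?_ (HasCompactSupport.of_compactSpace _)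
  exact ((continuous_quatCoord a).comp continuous_subtype_val).mul
    ((continuous_quatCoord b).comp continuous_subtype_val)

theorem integral_quatCoord_mul_left (p : SU2) (a b : Fin 4) :
    ∫ q : SU2, quatCoord a ((p : ℍ[ℝ]) * q) * quatCoord b ((p : ℍ[ℝ]) * q) ∂haarSU2 =
      ∫ q : SU2, quatCoord a q * quatCoord b q ∂haarSU2 :=
  integral_mul_left_eq_self (μ := haarSU2)
    (fun q : SU2 ↦ quatCoord a (q : ℍ[ℝ]) * quatCoord b (q : ℍ[ℝ])) p

theorem exists_SU2_coords {a b c d : ℝ} (h : a ^ 2 + b ^ 2 + c ^ 2 + d ^ 2 = 1) :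
    ∃ p : SU2, (p : ℍ[ℝ]).re = a ∧ (p : ℍ[ℝ]).imI = b ∧ (p : ℍ[ℝ]).imJ = c ∧
      (p : ℍ[ℝ]).imK = d := by
  let q : ℍ[ℝ] := ⟨a, b, c, d⟩
  have hq : ‖q‖ ^ 2 = 1 := by
    rw [sq, ← Quaternion.normSq_eq_norm_mul_self, Quaternion.normSq_def', h]
  exact ⟨⟨q, mem_sphere_zero_iff_norm.2 ((pow_eq_one_iff_of_nonneg (norm_nonneg q)
    two_ne_zero).1 hq)⟩, rfl, rfl, rfl, rfl⟩

/-- The second moments of the Haar measure: they follow from invariance under multiplication by the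
units `i` and `j`, which permute the coordinates up to sign, and from `a² + b² + c² + d² = 1`. -/
theorem integral_quatCoord_mul (a b : Fin 4) :
    ∫ q : SU2, quatCoord a q * quatCoord b q ∂haarSU2 = if a = b then 1 / 4 else 0 := by
  -- `p = i` and `r = j`
  obtain ⟨p, p0, p1, p2, p3⟩ := exists_SU2_coords (a := 0) (b := 1) (c := 0) (d := 0) (by norm_num)
  have hi := integral_quatCoord_mul_left p
  obtain ⟨r, r0, r1, r2, r3⟩ := exists_SU2_coords (a := 0) (b := 0) (c := 1) (d := 0) (by norm_num)
  have hj := integral_quatCoord_mul_left r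
  have hs : ∑ a, ∫ q : SU2, quatCoord a q * quatCoord a q ∂haarSU2 = 1 := by
    rw [← integral_finsetSum _ fun a _ ↦ integrable_quatCoord_mul a a]
    have : ∀ q : SU2, ∑ a, quatCoord a q * quatCoord a q = 1 := by
      rintro ⟨q, hq⟩
      have h2 : Quaternion.normSq q = 1 := by
        rw [Quaternion.normSq_eq_norm_mul_self, mem_sphere_zero_iff_norm.1 hq, one_mul]
      rw [Quaternion.normSq_def'] at h2
      simp only [Fin.sum_univ_four, quatCoord]
      simp only [Matrix.cons_val]
      linarith
    simp [this]
  set m : Fin 4 → Fin 4 → ℝ := fun a b ↦ ∫ q : SU2, quatCoord a q * quatCoord b q ∂haarSU2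
  have hm : ∀ a b, m a b = m b a := fun a b ↦ by simp only [m, mul_comm]
  -- `i` maps `(a, b, c, d)` to `(-b, a, -d, c)`, and `j` maps it to `(-c, d, a, -b)`.
  have i00 : m 1 1 = m 0 0 := by
    simpa [m, quatCoord, Quaternion.re_mul, Quaternion.imI_mul, Quaternion.imJ_mul,
      Quaternion.imK_mul, integral_neg, p0, p1, p2, p3] using hi 0 0
  have i22 : m 3 3 = m 2 2 := by
    simpa [m, quatCoord, Quaternion.re_mul, Quaternion.imI_mul, Quaternion.imJ_mul,
      Quaternion.imK_mul, integral_neg, p0, p1, p2, p3] using hi 2 2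
  have j00 : m 2 2 = m 0 0 := by
    simpa [m, quatCoord, Quaternion.re_mul, Quaternion.imI_mul, Quaternion.imJ_mul,
      Quaternion.imK_mul, integral_neg, r0, r1, r2, r3] using hj 0 0
  have i01 : -m 1 0 = m 0 1 := by
    simpa [m, quatCoord, Quaternion.re_mul, Quaternion.imI_mul, Quaternion.imJ_mul,
      Quaternion.imK_mul, integral_neg, p0, p1, p2, p3] using hi 0 1
  have i23 : -m 3 2 = m 2 3 := by
    simpa [m, quatCoord, Quaternion.re_mul, Quaternion.imI_mul, Quaternion.imJ_mul,
      Quaternion.imK_mul, integral_neg, p0, p1, p2, p3] using hi 2 3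
  have j02 : -m 2 0 = m 0 2 := by
    simpa [m, quatCoord, Quaternion.re_mul, Quaternion.imI_mul, Quaternion.imJ_mul,
      Quaternion.imK_mul, integral_neg, r0, r1, r2, r3] using hj 0 2
  have j13 : -m 3 1 = m 1 3 := by
    simpa [m, quatCoord, Quaternion.re_mul, Quaternion.imI_mul, Quaternion.imJ_mul,
      Quaternion.imK_mul, integral_neg, r0, r1, r2, r3] using hj 1 3
  have i03 : -m 1 2 = m 0 3 := by
    simpa [m, quatCoord, Quaternion.re_mul, Quaternion.imI_mul, Quaternion.imJ_mul,
      Quaternion.imK_mul, integral_neg, p0, p1, p2, p3] using hi 0 3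
  have j03 : m 2 1 = m 0 3 := by
    simpa [m, quatCoord, Quaternion.re_mul, Quaternion.imI_mul, Quaternion.imJ_mul,
      Quaternion.imK_mul, integral_neg, r0, r1, r2, r3] using hj 0 3
  rw [Fin.sum_univ_four] at hs
  change m 0 0 + m 1 1 + m 2 2 + m 3 3 = 1 at hs
  change m a b = _
  have h01 := hm 0 1
  have h02 := hm 0 2
  have h03 := hm 0 3
  have h12 := hm 1 2
  have h13 := hm 1 3
  have h23 := hm 2 3
  clear_value m
  fin_cases a <;> fin_cases b <;> simp <;> linarith

section Average

variable {E : Type*} [NormedAddCommGroup E] [NormedSpace ℝ E]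
  {M : Type*} [TopologicalSpace M] [ChartedSpace E M] [IsManifold 𝓘(ℝ, E) ∞ M]

/-- Averaging a bilinear form over `SU(2)` amounts to averaging it over `1`, `i`, `j`, `k`. -/
theorem HypercomplexStructure.integral_act (h : HypercomplexStructure E M) (x : M)
    (B : TangentSpace 𝓘(ℝ, E) x →L[ℝ] TangentSpace 𝓘(ℝ, E) x →L[ℝ] ℝ)
    (v w : TangentSpace 𝓘(ℝ, E) x) :
    ∫ q : SU2, B (h.act (q : ℍ[ℝ]) v) (h.act (q : ℍ[ℝ]) w) ∂haarSU2 =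
      1 / 4 * (B v w + B (h.I.toFun x v) (h.I.toFun x w) + B (h.J.toFun x v) (h.J.toFun x w)
        + B (h.K.toFun x v) (h.K.toFun x w)) := by
  let e : TangentSpace 𝓘(ℝ, E) x → Fin 4 → TangentSpace 𝓘(ℝ, E) x :=
    fun v ↦ ![v, h.I.toFun x v, h.J.toFun x v, h.K.toFun x v]
  have hact : ∀ (q : ℍ[ℝ]) v, h.act q v = ∑ a, quatCoord a q • e v a := fun q v ↦ by
    simp [Fin.sum_univ_four, HypercomplexStructure.act, quatCoord, e]
  have hexp : ∀ q : ℍ[ℝ], B (h.act q v) (h.act q w) =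
      ∑ a, ∑ b, quatCoord a q * quatCoord b q * B (e v a) (e w b) := fun q ↦ by
    rw [hact, hact, map_sum, Finset.sum_comm]
    refine Finset.sum_congr rfl fun b _ ↦ ?_
    rw [map_sum, sum_apply]
    refine Finset.sum_congr rfl fun a _ ↦ ?_
    rw [map_smul, ContinuousLinearMap.map_smul₂, smul_eq_mul, smul_eq_mul]
    ring
  simp_rw [hexp]
  rw [integral_finsetSum _ fun a _ ↦ integrable_finsetSum _ fun b _ ↦
    (integrable_quatCoord_mul a b).mul_const _]
  simp_rw [integral_finsetSum _ fun b _ ↦ (integrable_quatCoord_mul _ b).mul_const _,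
    integral_mul_const, integral_quatCoord_mul, ite_mul, zero_mul]
  simp only [Finset.sum_ite_eq, Finset.mem_univ, if_true, ← Finset.mul_sum]
  simp [Fin.sum_univ_four, e]

end Average

/-! ### Derivatives of forms and endomorphism fields on a vector space -/

section VectorSpace

variable {E F : Type*} [NormedAddCommGroup E] [NormedSpace ℝ E] [NormedAddCommGroup F]
  [NormedSpace ℝ F] {p : E}

theorem fderiv_comp_clm_apply {B : E → E →L[ℝ] F} {A : E → E →L[ℝ] E}
    (hB : DifferentiableAt ℝ B p) (hA : DifferentiableAt ℝ A p) (u v : E) :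
    fderiv ℝ (fun e ↦ B e (A e v)) p u = fderiv ℝ B p u (A p v) + B p (fderiv ℝ A p u v) := by
  have hAv : HasFDerivAt (fun e ↦ A e v) ((fderiv ℝ A p).flip v) p := by
    simpa using hA.hasFDerivAt.clm_apply (hasFDerivAt_const v p)
  rw [(hB.hasFDerivAt.clm_apply hAv).fderiv]
  simp [add_comm]

theorem fderiv_clm_apply_const {B : E → E →L[ℝ] F} (hB : DifferentiableAt ℝ B p) (u v : E) :
    fderiv ℝ (fun e ↦ B e v) p u = fderiv ℝ B p u v := by
  rw [(hB.hasFDerivAt.clm_apply (hasFDerivAt_const v p)).fderiv]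
  simp

set_option synthInstance.maxHeartbeats 200000 in
/-- A family of alternating `2`-forms is differentiable if the underlying family of bilinear maps
is: the former is half of the alternatization of the latter. -/
theorem differentiableAt_of_apply_eq {η : E → E [⋀^Fin 2]→L[ℝ] F} {B : E → E →L[ℝ] E →L[ℝ] F}
    (hB : DifferentiableAt ℝ B p) (h : ∀ᶠ e in 𝓝 p, ∀ v, η e v = B e (v 0) (v 1)) :
    DifferentiableAt ℝ η p := by
  let L : (E →L[ℝ] E →L[ℝ] F) →L[ℝ] E [⋀^Fin 2]→L[ℝ] F :=
    (ContinuousAlternatingMap.alternatizeUncurryFinCLM ℝ E F) ∘L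
      ContinuousLinearMap.compL ℝ E (E →L[ℝ] F) (E [⋀^Fin 1]→L[ℝ] F)
        (ContinuousAlternatingMap.ofSubsingletonLIE (𝕜 := ℝ) (E := E) (F := F)
          (0 : Fin 1)).toContinuousLinearEquiv
  have hL : ∀ᶠ e in 𝓝 p, η e = (1 / 2 : ℝ) • L (B e) := by
    filter_upwards [h] with e he
    ext v
    have h1 : η e ![v 1, v 0] = - η e v := by
      have := (η e).toAlternatingMap.map_swap v (show (0 : Fin 2) ≠ 1 by decide)
      rw [show ![v 1, v 0] = v ∘ Equiv.swap 0 1 by ext i; fin_cases i <;> simp]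
      exact this
    have h2 : B e (v 1) (v 0) = -B e (v 0) (v 1) := by rw [he, he] at h1; exact h1
    have h3 : L (B e) v = B e (v 0) (v 1) - B e (v 1) (v 0) := by
      simp [L, ContinuousAlternatingMap.alternatizeUncurryFin_apply, Fin.sum_univ_two,
        sub_eq_add_neg]
      rfl
    rw [ContinuousAlternatingMap.smul_apply, h3, h2, he]
    module
  refine DifferentiableAt.congr_of_eventuallyEq ?_ hL
  exact (L.differentiableAt.comp p hB).const_smul (1 / 2 : ℝ)

theorem extDeriv_eq_of_apply_eq {η : E → E [⋀^Fin 2]→L[ℝ] F} {B : E → E →L[ℝ] E →L[ℝ] F}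
    (hB : DifferentiableAt ℝ B p) (h : ∀ᶠ e in 𝓝 p, ∀ v, η e v = B e (v 0) (v 1))
    (v : Fin 3 → E) :
    extDeriv η p v = fderiv ℝ B p (v 0) (v 1) (v 2) - fderiv ℝ B p (v 1) (v 0) (v 2)
      + fderiv ℝ B p (v 2) (v 0) (v 1) := by
  have key : ∀ (u : E) (w : Fin 2 → E),
      fderiv ℝ (fun e ↦ η e w) p u = fderiv ℝ B p u (w 0) (w 1) := fun u w ↦ by
    have : (fun e ↦ η e w) =ᶠ[𝓝 p] fun e ↦ B e (w 0) (w 1) := by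
      filter_upwards [h] with e he using he w
    rw [this.fderiv_eq, fderiv_clm_apply_const (B := fun e ↦ B e (w 0))
      (hB.clm_apply (differentiableAt_const _)), fderiv_clm_apply_const hB]
  rw [extDeriv_apply (differentiableAt_of_apply_eq hB h), Fin.sum_univ_three]
  simp only [key]
  simp [Fin.removeNth, show Fin.succAbove (2 : Fin 3) 1 = 1 from rfl, sub_eq_add_neg]

theorem fderiv_clm_comp_apply {A B : E → E →L[ℝ] E} (hA : DifferentiableAt ℝ A p)
    (hB : DifferentiableAt ℝ B p) (u v : E) :
    fderiv ℝ (fun e ↦ A e ∘L B e) p u v = fderiv ℝ A p u (B p v) + A p (fderiv ℝ B p u v) := by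
  rw [← fderiv_clm_apply_const (hA.clm_comp hB), ← fderiv_comp_clm_apply hA hB]
  rfl

theorem fderiv_twoTensor_apply_const {B : E → E →L[ℝ] E →L[ℝ] F} (hB : DifferentiableAt ℝ B p)
    (u v w : E) : fderiv ℝ (fun e ↦ B e v w) p u = fderiv ℝ B p u v w := by
  rw [fderiv_clm_apply_const (B := fun e ↦ B e v) (hB.clm_apply (differentiableAt_const _)),
    fderiv_clm_apply_const hB]

theorem fderiv_twoTensor_apply_left {B : E → E →L[ℝ] E →L[ℝ] F} {A : E → E →L[ℝ] E}
    (hB : DifferentiableAt ℝ B p) (hA : DifferentiableAt ℝ A p) (u v w : E) :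
    fderiv ℝ (fun e ↦ B e (A e v) w) p u =
      fderiv ℝ B p u (A p v) w + B p (fderiv ℝ A p u v) w := by
  rw [fderiv_clm_apply_const (B := fun e ↦ B e (A e v))
    (hB.clm_apply (hA.clm_apply (differentiableAt_const _))), fderiv_comp_clm_apply hB hA]
  rfl

theorem fderiv_twoTensor_apply_right {B : E → E →L[ℝ] E →L[ℝ] F} {A : E → E →L[ℝ] E}
    (hB : DifferentiableAt ℝ B p) (hA : DifferentiableAt ℝ A p) (u v w : E) :
    fderiv ℝ (fun e ↦ B e v (A e w)) p u =
      fderiv ℝ B p u v (A p w) + B p v (fderiv ℝ A p u w) := by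
  rw [fderiv_comp_clm_apply (B := fun e ↦ B e v) (hB.clm_apply (differentiableAt_const _)) hA,
    fderiv_clm_apply_const hB]

/-- The conditions on the derivatives are obtained by differentiating the algebraic identities. -/
theorem isHypercomplexJet_of_eventually {I J : E → E →L[ℝ] E} (hI : DifferentiableAt ℝ I p)
    (hJ : DifferentiableAt ℝ J p) (hII : ∀ᶠ e in 𝓝 p, ∀ x, I e (I e x) = -x)
    (hJJ : ∀ᶠ e in 𝓝 p, ∀ x, J e (J e x) = -x)
    (hJI : ∀ᶠ e in 𝓝 p, ∀ x, J e (I e x) = -I e (J e x))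
    (nI : ∀ x y, nijenhuisJet (I p) (fderiv ℝ I p) x y = 0)
    (nJ : ∀ x y, nijenhuisJet (J p) (fderiv ℝ J p) x y = 0) :
    IsHypercomplexJet (I p) (J p) (fderiv ℝ I p) (fderiv ℝ J p) := by
  have sq : ∀ {A : E → E →L[ℝ] E}, DifferentiableAt ℝ A p →
      (∀ᶠ e in 𝓝 p, ∀ x, A e (A e x) = -x) →
      ∀ v x, fderiv ℝ A p v (A p x) = -A p (fderiv ℝ A p v x) := by
    intro A hA hAA v x
    have e1 : (fun e ↦ A e (A e x)) =ᶠ[𝓝 p] fun _ ↦ -x := by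
      filter_upwards [hAA] with e he using he x
    have e2 := fderiv_comp_clm_apply hA hA v x
    rw [e1.fderiv_eq] at e2
    simp only [fderiv_fun_const, Pi.zero_apply, zero_apply] at e2
    exact eq_neg_of_add_eq_zero_left e2.symm
  refine ⟨hII.self_of_nhds, hJJ.self_of_nhds, hJI.self_of_nhds, sq hI hII, sq hJ hJJ, ?_, nI, nJ⟩
  intro v x
  have e1 : (fun e ↦ J e (I e x)) =ᶠ[𝓝 p] fun e ↦ -I e (J e x) := by
    filter_upwards [hJI] with e he using he x
  have e2 := fderiv_comp_clm_apply hJ hI v x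
  rw [e1.fderiv_eq, fderiv_fun_neg, _root_.neg_apply, fderiv_comp_clm_apply hI hJ] at e2
  rw [eq_sub_iff_add_eq, ← e2]
  abel

set_option synthInstance.maxHeartbeats 200000 in
/-- The symmetries of the derivative are obtained by differentiating those of the form. -/
theorem isKahlerJet_of_eventually {I : E → E →L[ℝ] E} {B : E → E →L[ℝ] E →L[ℝ] ℝ}
    (hI : DifferentiableAt ℝ I p) (hB : DifferentiableAt ℝ B p)
    (hanti : ∀ᶠ e in 𝓝 p, ∀ x y, B e x y = -B e y x)
    (hBI : ∀ᶠ e in 𝓝 p, ∀ x y, B e (I e x) y = -B e x (I e y))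
    (hclosed : ∀ x y z, fderiv ℝ B p x y z - fderiv ℝ B p y x z + fderiv ℝ B p z x y = 0) :
    IsKahlerJet (I p) (fderiv ℝ I p) (fun x y ↦ B p x y) (fun v x y ↦ fderiv ℝ B p v x y) := by
  have hd : ∀ v x y, fderiv ℝ B p v x y = -fderiv ℝ B p v y x := fun v x y ↦ by
    have e1 : (fun e ↦ B e x y) =ᶠ[𝓝 p] fun e ↦ -B e y x := by
      filter_upwards [hanti] with e he using he x y
    have e2 := fderiv_twoTensor_apply_const hB v x y
    rw [e1.fderiv_eq, fderiv_fun_neg, _root_.neg_apply, fderiv_twoTensor_apply_const hB] at e2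
    exact e2.symm
  refine ⟨fun x x' y ↦ (B p).map_add₂ _ _ _, fun c x y ↦ (B p).map_smul₂ _ _ _, fun v x y ↦ ?_,
    fun v x y ↦ map_neg _ _, hanti.self_of_nhds, hd, hBI.self_of_nhds, fun v x y ↦ ?_,
    fun x y z ↦ ?_⟩
  · exact congrArg (fun L : E →L[ℝ] E →L[ℝ] ℝ ↦ L x y) ((fderiv ℝ B p).map_neg v)
  · have e1 : (fun e ↦ B e (I e x) y) =ᶠ[𝓝 p] fun e ↦ -B e x (I e y) := by
      filter_upwards [hBI] with e he using he x y
    have e2 := fderiv_twoTensor_apply_left hB hI v x y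
    rw [e1.fderiv_eq, fderiv_fun_neg, _root_.neg_apply, fderiv_twoTensor_apply_right hB hI] at e2
    linarith
  · linarith [hclosed x y z, hd y x z]

theorem fderiv_eq_twistJet {A : E → E →L[ℝ] E} {B C : E → E →L[ℝ] E →L[ℝ] ℝ} {c : ℝ}
    (hA : DifferentiableAt ℝ A p) (hB : DifferentiableAt ℝ B p) (hC : DifferentiableAt ℝ C p)
    (h : ∀ᶠ e in 𝓝 p, ∀ v w, C e v w = c * (B e (A e v) w + B e v (A e w))) (u v w : E) :
    fderiv ℝ C p u v w = c * twistJet (fun x y ↦ B p x y) (fun v x y ↦ fderiv ℝ B p v x y)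
      (A p) (fderiv ℝ A p) u v w := by
  have e1 : (fun e ↦ C e v w) =ᶠ[𝓝 p] fun e ↦ c * (B e (A e v) w + B e v (A e w)) := by
    filter_upwards [h] with e he using he v w
  have hv : DifferentiableAt ℝ (fun e ↦ B e (A e v) w) p :=
    (hB.clm_apply (hA.clm_apply (differentiableAt_const _))).clm_apply (differentiableAt_const _)
  have hw : DifferentiableAt ℝ (fun e ↦ B e v (A e w)) p :=
    (hB.clm_apply (differentiableAt_const _)).clm_apply (hA.clm_apply (differentiableAt_const _))
  rw [← fderiv_twoTensor_apply_const hC, e1.fderiv_eq, fderiv_const_mul (hv.fun_add hw),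
    fderiv_fun_add hv hw, _root_.smul_apply, _root_.add_apply, fderiv_twoTensor_apply_left hB hA,
    fderiv_twoTensor_apply_right hB hA, smul_eq_mul]
  rfl

theorem extDeriv_eq_dTwistJet {η : E → E [⋀^Fin 2]→L[ℝ] ℝ} {A : E → E →L[ℝ] E}
    {B C : E → E →L[ℝ] E →L[ℝ] ℝ} {c : ℝ} (hA : DifferentiableAt ℝ A p)
    (hB : DifferentiableAt ℝ B p) (hC : DifferentiableAt ℝ C p)
    (hη : ∀ᶠ e in 𝓝 p, ∀ v, η e v = C e (v 0) (v 1))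
    (h : ∀ᶠ e in 𝓝 p, ∀ v w, C e v w = c * (B e (A e v) w + B e v (A e w))) (v : Fin 3 → E) :
    extDeriv η p v = c * dTwistJet (fun x y ↦ B p x y) (fun v x y ↦ fderiv ℝ B p v x y)
      (A p) (fderiv ℝ A p) (v 0) (v 1) (v 2) := by
  rw [extDeriv_eq_of_apply_eq hC hη, fderiv_eq_twistJet hA hB hC h, fderiv_eq_twistJet hA hB hC h,
    fderiv_eq_twistJet hA hB hC h, dTwistJet]
  ring

end VectorSpace

/-! ### Tensor fields and Nijenhuis tensors in a chart -/

noncomputable section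

variable {E : Type*} [NormedAddCommGroup E] [NormedSpace ℝ E]
  {M : Type*} [TopologicalSpace M] [ChartedSpace E M] [IsManifold 𝓘(ℝ, E) ∞ M]

/-- The coordinate frame of the chart at `x`: the isomorphism `E → T_y M` given by that chart
if `y` lies in its source. For other `y` the value carries no meaning. -/
def frame (x y : M) : E →L[ℝ] TangentSpace 𝓘(ℝ, E) y :=
  (trivializationAt E (TangentSpace 𝓘(ℝ, E)) x).symmL ℝ y

/-- The coordinates of a tangent vector at `y` in the chart at `x`: the inverse of `frame x y` if
`y` lies in the source of the chart. For other `y` the value carries no meaning. -/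
def coframe (x y : M) : TangentSpace 𝓘(ℝ, E) y →L[ℝ] E :=
  (trivializationAt E (TangentSpace 𝓘(ℝ, E)) x).continuousLinearMapAt ℝ y

/-- A field of endomorphisms of the tangent bundle, read in the chart at `x`. -/
def endoInChart (A : Π y : M, TangentSpace 𝓘(ℝ, E) y →L[ℝ] TangentSpace 𝓘(ℝ, E) y) (x : M)
    (e : E) : E →L[ℝ] E :=
  let y := (extChartAt 𝓘(ℝ, E) x).symm e
  coframe x y ∘L A y ∘L frame x y

/-- A field of bilinear forms on the tangent bundle, read in the chart at `x`. -/
def bilinInChart (B : Π y : M, TangentSpace 𝓘(ℝ, E) y →L[ℝ] TangentSpace 𝓘(ℝ, E) y →L[ℝ] ℝ)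
    (x : M) (e : E) : E →L[ℝ] E →L[ℝ] ℝ :=
  let y := (extChartAt 𝓘(ℝ, E) x).symm e
  ContinuousLinearMap.bilinearComp (E := E) (F := E) (B y) (frame x y) (frame x y)

theorem frame_coframe {x y : M} (hy : y ∈ (chartAt E x).source) (v : TangentSpace 𝓘(ℝ, E) y) :
    frame x y (coframe x y v) = v :=
  (trivializationAt E (TangentSpace 𝓘(ℝ, E)) x).symmL_continuousLinearMapAt (by simpa using hy) v

theorem coframe_frame {x y : M} (hy : y ∈ (chartAt E x).source) (v : E) :
    coframe x y (frame x y v) = v :=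
  (trivializationAt E (TangentSpace 𝓘(ℝ, E)) x).continuousLinearMapAt_symmL (by simpa using hy) v

theorem inverse_coframe {x y : M} (hy : y ∈ (chartAt E x).source) :
    (coframe (E := E) x y).inverse = frame x y :=
  ContinuousLinearMap.inverse_eq (ContinuousLinearMap.ext fun v ↦ coframe_frame hy v)
    (ContinuousLinearMap.ext fun v ↦ frame_coframe hy v)

theorem inverse_frame {x y : M} (hy : y ∈ (chartAt E x).source) :
    (frame (E := E) x y).inverse = coframe x y :=
  ContinuousLinearMap.inverse_eq (ContinuousLinearMap.ext fun v ↦ frame_coframe hy v)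
    (ContinuousLinearMap.ext fun v ↦ coframe_frame hy v)

theorem mfderiv_extChartAt_eq_coframe {x y : M} (hy : y ∈ (chartAt E x).source) :
    mfderiv 𝓘(ℝ, E) 𝓘(ℝ, E) (extChartAt 𝓘(ℝ, E) x) y = coframe x y :=
  have : IsManifold 𝓘(ℝ, E) 1 M := .of_le (n := ∞) (by simp)
  (TangentBundle.continuousLinearMapAt_trivializationAt hy).symm

theorem mfderiv_extChartAt_symm_eq_frame {x y : M} (hy : y ∈ (chartAt E x).source) :
    mfderiv 𝓘(ℝ, E) 𝓘(ℝ, E) (extChartAt 𝓘(ℝ, E) x).symm (extChartAt 𝓘(ℝ, E) x y) =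
      frame (E := E) x y := by
  have : IsManifold 𝓘(ℝ, E) 1 M := .of_le (n := ∞) (by simp)
  have := TangentBundle.symmL_trivializationAt (I := 𝓘(ℝ, E)) hy
  simp only [modelWithCornersSelf_coe, Set.range_id, mfderivWithin_univ] at this
  exact this.symm

theorem frame_endoInChart (A : Π y : M, TangentSpace 𝓘(ℝ, E) y →L[ℝ] TangentSpace 𝓘(ℝ, E) y)
    {x y : M} (hy : y ∈ (chartAt E x).source) (v : E) :
    frame x y (endoInChart A x (extChartAt 𝓘(ℝ, E) x y) v) = A y (frame x y v) := by
  have hy' := (extChartAt 𝓘(ℝ, E) x).left_inv (by simpa using hy)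
  simp only [endoInChart]
  rw [hy']
  exact frame_coframe hy _

theorem bilinInChart_apply
    (B : Π y : M, TangentSpace 𝓘(ℝ, E) y →L[ℝ] TangentSpace 𝓘(ℝ, E) y →L[ℝ] ℝ)
    {x y : M} (hy : y ∈ (chartAt E x).source) (v w : E) :
    bilinInChart B x (extChartAt 𝓘(ℝ, E) x y) v w = B y (frame x y v) (frame x y w) := by
  have hy' := (extChartAt 𝓘(ℝ, E) x).left_inv (by simpa using hy)
  simp only [bilinInChart]
  rw [hy']
  rfl

omit [IsManifold 𝓘(ℝ, E) ∞ M] in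
theorem contMDiffAt_comp_extChartAt_symm {F : Type*} [NormedAddCommGroup F] [NormedSpace ℝ F]
    {f : M → F} {x : M} (hf : ContMDiffAt 𝓘(ℝ, E) 𝓘(ℝ, F) ∞ f x) :
    ContDiffAt ℝ ∞ (fun e ↦ f ((extChartAt 𝓘(ℝ, E) x).symm e)) (extChartAt 𝓘(ℝ, E) x x) := by
  have := (contMDiffAt_iff.1 hf).2
  simpa [contDiffWithinAt_univ, chartAt_self_eq, Function.comp_def] using this

theorem differentiableAt_endoInChart
    {A : Π y : M, TangentSpace 𝓘(ℝ, E) y →L[ℝ] TangentSpace 𝓘(ℝ, E) y}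
    (hA : ContMDiff 𝓘(ℝ, E) (𝓘(ℝ, E).prod 𝓘(ℝ, E →L[ℝ] E)) ∞
      (fun x ↦ TotalSpace.mk' (E →L[ℝ] E)
        (E := fun x : M ↦ TangentSpace 𝓘(ℝ, E) x →L[ℝ] TangentSpace 𝓘(ℝ, E) x) x (A x))) (x : M) :
    DifferentiableAt ℝ (endoInChart A x) (extChartAt 𝓘(ℝ, E) x x) :=
  (contMDiffAt_comp_extChartAt_symm ((contMDiffAt_hom_bundle _).1 (hA x)).2).differentiableAt
    (by simp)

theorem differentiableAt_bilinInChart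
    {B : Π y : M, TangentSpace 𝓘(ℝ, E) y →L[ℝ] TangentSpace 𝓘(ℝ, E) y →L[ℝ] ℝ}
    (hB : ContMDiff 𝓘(ℝ, E) (𝓘(ℝ, E).prod 𝓘(ℝ, E →L[ℝ] E →L[ℝ] ℝ)) ∞
      (fun x ↦ TotalSpace.mk' (E →L[ℝ] E →L[ℝ] ℝ)
        (E := fun x : M ↦ TangentSpace 𝓘(ℝ, E) x →L[ℝ] TangentSpace 𝓘(ℝ, E) x →L[ℝ] ℝ) x (B x)))
    (x : M) : DifferentiableAt ℝ (bilinInChart B x) (extChartAt 𝓘(ℝ, E) x x) := by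
  have := (contMDiffAt_comp_extChartAt_symm
    ((contMDiffAt_hom_bundle _).1 (hB x)).2).differentiableAt (by simp)
  refine this.congr_of_eventuallyEq ?_
  filter_upwards [extChartAt_target_mem_nhds (I := 𝓘(ℝ, E)) x] with e he
  ext v w
  have hy : (extChartAt 𝓘(ℝ, E) x).symm e ∈ (chartAt E x).source := by
    simpa using (extChartAt 𝓘(ℝ, E) x).map_target he
  rw [inCoordinates_apply_eq₂ (by simpa using hy) (by simpa using hy) (by simp)]
  have hs : ∀ v, (trivializationAt E (TangentSpace 𝓘(ℝ, E)) x).symm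
      ((extChartAt 𝓘(ℝ, E) x).symm e) v = frame x ((extChartAt 𝓘(ℝ, E) x).symm e) v := fun v ↦
    (Trivialization.symmL_apply _ (by simpa using hy) v).symm
  rw [hs, hs]
  simp
  rfl

theorem contMDiffAt_frame (x : M) (u : E) :
    ContMDiffAt 𝓘(ℝ, E) 𝓘(ℝ, E).tangent ∞
      (fun y ↦ (⟨y, frame x y u⟩ : TangentBundle 𝓘(ℝ, E) M)) x := by
  rw [contMDiffAt_section]
  refine (contMDiffAt_const (c := u)).congr_of_eventuallyEq ?_
  filter_upwards [chart_source_mem_nhds E x] with y hy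
  have := coframe_frame hy u
  rw [coframe, Trivialization.continuousLinearMapAt_apply, Trivialization.coe_linearMapAt_of_mem _
    (by simpa using hy)] at this
  exact this

/-- The Lie bracket of vector fields on `M` is computed in coordinates. -/
theorem mlieBracket_eq_frame_lieBracket {x : M} {X Y : Π y : M, TangentSpace 𝓘(ℝ, E) y}
    {U W : E → E}
    (hX : ∀ y ∈ (chartAt E x).source, X y = frame x y (U (extChartAt 𝓘(ℝ, E) x y)))
    (hY : ∀ y ∈ (chartAt E x).source, Y y = frame x y (W (extChartAt 𝓘(ℝ, E) x y))) :
    mlieBracket 𝓘(ℝ, E) X Y x = frame x x (lieBracket ℝ U W (extChartAt 𝓘(ℝ, E) x x)) := by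
  have pull : ∀ {X : Π y : M, TangentSpace 𝓘(ℝ, E) y} {U : E → E},
      (∀ y ∈ (chartAt E x).source, X y = frame x y (U (extChartAt 𝓘(ℝ, E) x y))) →
      mpullbackWithin 𝓘(ℝ, E) 𝓘(ℝ, E) (extChartAt 𝓘(ℝ, E) x).symm X (Set.range 𝓘(ℝ, E))
        =ᶠ[𝓝 (extChartAt 𝓘(ℝ, E) x x)] U := by
    intro X U hX
    filter_upwards [extChartAt_target_mem_nhds (I := 𝓘(ℝ, E)) x] with e he
    have hy : (extChartAt 𝓘(ℝ, E) x).symm e ∈ (chartAt E x).source := by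
      simpa using (extChartAt 𝓘(ℝ, E) x).map_target he
    have hr := (extChartAt 𝓘(ℝ, E) x).right_inv he
    have hf := mfderiv_extChartAt_symm_eq_frame hy
    rw [hr] at hf
    simp only [mpullbackWithin_apply, modelWithCornersSelf_coe, Set.range_id, mfderivWithin_univ]
    rw [hX _ hy, hr, hf]
    exact (DFunLike.congr_fun (inverse_frame hy) _).trans (coframe_frame hy _)
  rw [← mlieBracketWithin_univ, mlieBracketWithin_apply, mfderiv_extChartAt_eq_coframe
    (mem_chart_source E x)]
  refine (DFunLike.congr_fun (inverse_coframe (mem_chart_source E x)) _).trans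
    (congrArg (frame x x) ?_)
  rw [show (extChartAt 𝓘(ℝ, E) x).symm ⁻¹' Set.univ ∩ Set.range 𝓘(ℝ, E) = Set.univ by simp]
  exact (congrFun lieBracketWithin_univ _).trans
    (EventuallyEq.lieBracket_vectorField_eq (pull hX) (pull hY))

/-- Integrability, applied to the vector fields with constant coordinates `u` and `w`. -/
theorem ComplexStructure.nijenhuisJet_eq_zero (J : ComplexStructure E M) (x : M) (u w : E) :
    nijenhuisJet (endoInChart J.toFun x (extChartAt 𝓘(ℝ, E) x x))
      (fderiv ℝ (endoInChart J.toFun x) (extChartAt 𝓘(ℝ, E) x x)) u w = 0 := by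
  have hd := differentiableAt_endoInChart J.smooth x
  have h := J.integrable (fun y ↦ frame x y u) (fun y ↦ frame x y w) x (contMDiffAt_frame x u)
    (contMDiffAt_frame x w)
  have hJ : ∀ u, ∀ y ∈ (chartAt E x).source, J.toFun y (frame x y u) =
      frame x y (endoInChart J.toFun x (extChartAt 𝓘(ℝ, E) x y) u) :=
    fun u y hy ↦ (frame_endoInChart J.toFun hy u).symm
  rw [mlieBracket_eq_frame_lieBracket (U := fun e ↦ endoInChart J.toFun x e u)
      (W := fun e ↦ endoInChart J.toFun x e w) (hJ u) (hJ w),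
    mlieBracket_eq_frame_lieBracket (U := fun e ↦ endoInChart J.toFun x e u)
      (W := fun _ ↦ w) (hJ u) (fun _ _ ↦ rfl),
    mlieBracket_eq_frame_lieBracket (U := fun _ ↦ u)
      (W := fun e ↦ endoInChart J.toFun x e w) (fun _ _ ↦ rfl) (hJ w),
    mlieBracket_eq_frame_lieBracket (U := fun _ ↦ u) (W := fun _ ↦ w) (fun _ _ ↦ rfl)
      (fun _ _ ↦ rfl),
    ← frame_endoInChart J.toFun (mem_chart_source E x) _,
    ← frame_endoInChart J.toFun (mem_chart_source E x) _, ← map_sub, ← map_sub, ← map_sub] at h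
  have h0 := congrArg (coframe x x) h
  rw [coframe_frame (mem_chart_source E x), map_zero] at h0
  simp only [lieBracket, fderiv_fun_const, fderiv_clm_apply_const hd, Pi.zero_apply, zero_apply,
    zero_sub, sub_zero, map_neg] at h0
  rw [← h0, nijenhuisJet]
  abel

end

/-! ### Complex-valued forms and the averaged metric -/

section VectorSpace

variable {E : Type*} [NormedAddCommGroup E] [NormedSpace ℝ E]

/-- The `(3, 0)`-part of a complex-valued `3`-form vanishes as soon as its real part does, since the
imaginary part at `(x, y, z)` is minus the real part at `(A x, y, z)`. -/
theorem holPart_eq_zero_of_re {A : E →L[ℝ] E} (hA : ∀ x, A (A x) = -x) {α : E [⋀^Fin 3]→L[ℝ] ℂ}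
    {β γ : E → E → E → ℝ}
    (hα : ∀ v, α v = (β (v 0) (v 1) (v 2) : ℂ) + Complex.I * (γ (v 0) (v 1) (v 2) : ℂ))
    (hβ : ∀ x y z, β (-x) y z = -β x y z) (hγ : ∀ x y z, γ (-x) y z = -γ x y z)
    (hre : ∀ x y z, β x y z - β (A x) (A y) z - β (A x) y (A z) - β x (A y) (A z)
      + (γ (A x) y z + γ x (A y) z + γ x y (A z) - γ (A x) (A y) (A z)) = 0) :
    holPart A α = 0 := by
  ext v
  change (1 / 2 : ℂ) ^ 3 * ∑ S : Finset (Fin 3), (-Complex.I) ^ S.card * α (applyOn A S v) = 0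
  have hS : (Finset.univ : Finset (Finset (Fin 3))) =
      {∅, {0}, {1}, {2}, {0, 1}, {0, 2}, {1, 2}, {0, 1, 2}} := by decide
  have h1 := hre (v 0) (v 1) (v 2)
  have h2 := hre (A (v 0)) (v 1) (v 2)
  simp only [hA, hβ, hγ] at h2
  rw [hS]
  repeat rw [Finset.sum_insert (by decide)]
  rw [Finset.sum_singleton]
  simp [applyOn, hα]
  have e1 := congrArg (fun t : ℝ ↦ (t : ℂ)) h1
  have e2 := congrArg (fun t : ℝ ↦ (t : ℂ)) h2
  push_cast at e1 e2
  have hI := Complex.I_sq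
  have hI3 : Complex.I ^ 3 = -Complex.I := by rw [pow_succ, hI]; ring
  ring_nf
  simp only [hI, hI3, Complex.I_pow_four]
  linear_combination e1 - Complex.I * e2

/-- The exterior derivative of a complex-valued form is computed on real and imaginary parts. -/
theorem extDeriv_re_add_im {k : ℕ} {p : E} {η : E → E [⋀^Fin k]→L[ℝ] ℂ}
    {β γ : E → E [⋀^Fin k]→L[ℝ] ℝ} (hβ : DifferentiableAt ℝ β p) (hγ : DifferentiableAt ℝ γ p)
    (h : ∀ e v, η e v = (β e v : ℂ) + Complex.I * (γ e v : ℂ)) (v : Fin (k + 1) → E) :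
    extDeriv η p v = (extDeriv β p v : ℂ) + Complex.I * (extDeriv γ p v : ℂ) := by
  have post : ∀ (l : ℝ →L[ℝ] ℂ) {β : E → E [⋀^Fin k]→L[ℝ] ℝ}, DifferentiableAt ℝ β p →
      DifferentiableAt ℝ (fun e ↦ l.compContinuousAlternatingMap (β e)) p ∧
      extDeriv (fun e ↦ l.compContinuousAlternatingMap (β e)) p v = l (extDeriv β p v) := by
    intro l β hβ
    have hd : HasFDerivAt (fun e ↦ l.compContinuousAlternatingMap (β e)) _ p :=
      (l.compContinuousAlternatingMapCLM ℝ E ℝ ℂ (Fin k)).hasFDerivAt.comp p hβ.hasFDerivAt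
    refine ⟨hd.differentiableAt, ?_⟩
    rw [extDeriv, extDeriv, hd.fderiv]
    simp only [ContinuousAlternatingMap.alternatizeUncurryFin_apply, map_sum, map_zsmul]
    rfl
  have hη : η = fun e ↦ Complex.ofRealCLM.compContinuousAlternatingMap (β e) +
      (Complex.I • Complex.ofRealCLM).compContinuousAlternatingMap (γ e) := by
    ext e v
    simp [h]
  obtain ⟨d1, e1⟩ := post Complex.ofRealCLM hβ
  obtain ⟨d2, e2⟩ := post (Complex.I • Complex.ofRealCLM) hγ
  rw [hη, extDeriv_fun_add d1 d2, ContinuousAlternatingMap.add_apply, e1, e2]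
  simp

end VectorSpace

section AveragedMetric

variable {E : Type*} [NormedAddCommGroup E] [NormedSpace ℝ E]
  {M : Type*} [TopologicalSpace M] [ChartedSpace E M] [IsManifold 𝓘(ℝ, E) ∞ M]

/-- The average `(B + B(A·, A·)) / 2` of a bilinear form `B` over an endomorphism `A`. -/
noncomputable def averagedForm {V : Type*} [NormedAddCommGroup V] [NormedSpace ℝ V]
    (B : V →L[ℝ] V →L[ℝ] ℝ) (A : V →L[ℝ] V) : V →L[ℝ] V →L[ℝ] ℝ :=
  (1 / 2 : ℝ) • (B + ((B ∘L A).flip ∘L A).flip)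

set_option synthInstance.maxHeartbeats 200000 in
theorem contDiff_averagedForm {V : Type*} [NormedAddCommGroup V] [NormedSpace ℝ V] :
    ContDiff ℝ ∞ fun q : (V →L[ℝ] V →L[ℝ] ℝ) × (V →L[ℝ] V) ↦ averagedForm q.1 q.2 := by
  have hflip : ContDiff ℝ ∞ fun B : V →L[ℝ] V →L[ℝ] ℝ ↦ B.flip :=
    LinearIsometryEquiv.contDiff (𝕜 := ℝ) (E := V →L[ℝ] V →L[ℝ] ℝ) (F := V →L[ℝ] V →L[ℝ] ℝ)
      (ContinuousLinearMap.flipₗᵢ ℝ V V ℝ)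
  exact (contDiff_fst.add (hflip.comp
    ((hflip.comp (contDiff_fst.clm_comp contDiff_snd)).clm_comp contDiff_snd))).const_smul _

/-- The average of the metric `g` over the complex structure `J`: `(g + g(J·, J·)) / 2`. -/
noncomputable def averagedMetric (J : ComplexStructure E M) (g : RiemMetric E M) :
    RiemMetric E M where
  inner y := averagedForm (V := E) (g.inner y) (J.toFun y)
  symm y v w := by
    change (1 / 2 : ℝ) * (g.inner y v w + g.inner y (J.toFun y v) (J.toFun y w)) =
      (1 / 2 : ℝ) * (g.inner y w v + g.inner y (J.toFun y w) (J.toFun y v))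
    rw [g.symm y v, g.symm y (J.toFun y v)]
  pos y v hv := by
    change 0 < (1 / 2 : ℝ) * (g.inner y v v + g.inner y (J.toFun y v) (J.toFun y v))
    have hJ : J.toFun y v ≠ 0 := fun h ↦ hv <| by
      rw [← neg_eq_zero, ← J.sq_eq_neg, h, map_zero]
    linarith [g.pos y v hv, g.pos y _ hJ]
  isVonNBounded y := by
    -- `g ≤ 2 g₁`, so the unit ball of `g₁` lies in twice that of `g`.
    refine ((g.isVonNBounded y).image (σ := RingHom.id ℝ)
      ((2 : ℝ) • ContinuousLinearMap.id ℝ (TangentSpace 𝓘(ℝ, E) y))).subset ?_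
    intro v hv
    change (1 / 2 : ℝ) * (g.inner y v v + g.inner y (J.toFun y v) (J.toFun y v)) < 1 at hv
    have hJ : 0 ≤ g.inner y (J.toFun y v) (J.toFun y v) := by
      by_cases h : J.toFun y v = 0
      · simp [h]
      · exact (g.pos y _ h).le
    refine ⟨(1 / 2 : ℝ) • v, ?_, ?_⟩
    · change g.inner y ((1 / 2 : ℝ) • v) ((1 / 2 : ℝ) • v) < 1
      rw [map_smul, ContinuousLinearMap.map_smul₂, smul_eq_mul, smul_eq_mul]
      linarith
    · simp [smul_smul]
  contMDiff := by
    intro x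
    have hg := ((contMDiffAt_hom_bundle _).1 (g.contMDiff x)).2
    have hJ := ((contMDiffAt_hom_bundle _).1 (J.smooth x)).2
    refine (contMDiffAt_hom_bundle _).2 ⟨contMDiffAt_id, ?_⟩
    -- In coordinates averaging is the smooth map `averagedForm`.
    refine (contDiff_averagedForm.contMDiff.contMDiffAt.comp x
      (hg.prodMk_space hJ)).congr_of_eventuallyEq ?_
    filter_upwards [chart_source_mem_nhds E x] with y hy
    ext v w
    have hs : ∀ v, (trivializationAt E (TangentSpace 𝓘(ℝ, E)) x).symm y v = frame x y v := fun v ↦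
      (Trivialization.symmL_apply _ (by simpa using hy) v).symm
    have hG : ∀ (B : TangentSpace 𝓘(ℝ, E) y →L[ℝ] TangentSpace 𝓘(ℝ, E) y →L[ℝ] ℝ) (v w : E),
        ContinuousLinearMap.inCoordinates E (TangentSpace 𝓘(ℝ, E)) (E →L[ℝ] ℝ)
          (fun y : M ↦ TangentSpace 𝓘(ℝ, E) y →L[ℝ] ℝ) x y x y B v w =
        B (frame x y v) (frame x y w) := fun B v w ↦ by
      rw [inCoordinates_apply_eq₂ (by simpa using hy) (by simpa using hy) (by simp), hs, hs]
      simp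
    have hA : ∀ v : E, frame x y (ContinuousLinearMap.inCoordinates E (TangentSpace 𝓘(ℝ, E)) E
        (TangentSpace 𝓘(ℝ, E)) x y x y (J.toFun y) v) = J.toFun y (frame x y v) :=
      fun v ↦ frame_coframe hy _
    refine (hG _ v w).trans ?_
    refine Eq.trans ?_
      (congrArg₂ (fun a b : ℝ ↦ (1 / 2 : ℝ) * (a + b)) (hG _ _ _) (hG _ _ _)).symm
    exact congrArg₂ (fun a b : TangentSpace 𝓘(ℝ, E) y ↦ (1 / 2 : ℝ) *
      (g.inner y (frame x y v) (frame x y w) + g.inner y a b)) (hA v).symm (hA w).symm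

theorem averagedMetric_apply (J : ComplexStructure E M) (g : RiemMetric E M) (y : M)
    (v w : TangentSpace 𝓘(ℝ, E) y) : (averagedMetric J g).inner y v w =
      (1 / 2 : ℝ) * (g.inner y v w + g.inner y (J.toFun y v) (J.toFun y w)) := rfl

theorem HypercomplexStructure.isQuaternionicHermitian_averagedMetric (h : HypercomplexStructure E M)
    {g : RiemMetric E M} (hg : h.I.IsHermitian g) :
    h.IsQuaternionicHermitian (averagedMetric h.J g) := by
  have hJI : ∀ x v, h.J.toFun x (h.I.toFun x v) = -h.I.toFun x (h.J.toFun x v) := fun x v ↦ by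
    rw [h.J_I, h.I_J]
  have hneg : ∀ x (v w : TangentSpace 𝓘(ℝ, E) x), g.inner x (-v) (-w) = g.inner x v w :=
    fun x v w ↦ by rw [map_neg, ContinuousLinearMap.map_neg₂, neg_neg]
  refine ⟨fun x v w ↦ ?_, fun x v w ↦ ?_, fun x v w ↦ ?_⟩
  · rw [averagedMetric_apply, averagedMetric_apply, hJI, hJI, hneg, hg, hg]
  · rw [averagedMetric_apply, averagedMetric_apply, h.J.sq_eq_neg, h.J.sq_eq_neg, hneg, add_comm]
  · rw [averagedMetric_apply, averagedMetric_apply, ← h.I_J, ← h.I_J, hJI, hJI, h.J.sq_eq_neg,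
      h.J.sq_eq_neg, hneg, hg, hg, hneg, add_comm]

theorem HypercomplexStructure.isAverage_averagedMetric (h : HypercomplexStructure E M)
    {g : RiemMetric E M} (hg : h.I.IsHermitian g) : h.IsAverage (averagedMetric h.J g) g := by
  intro x v w
  rw [h.integral_act, averagedMetric_apply, ← h.I_J, ← h.I_J, hg, hg]
  ring

end AveragedMetric

/-! ### The HKT condition in a chart -/

noncomputable section

variable {E : Type*} [NormedAddCommGroup E] [NormedSpace ℝ E]
  {M : Type*} [TopologicalSpace M] [ChartedSpace E M] [IsManifold 𝓘(ℝ, E) ∞ M]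

omit [IsManifold 𝓘(ℝ, E) ∞ M] in
theorem eventually_extChartAt {P : E → Prop} (x : M)
    (h : ∀ y ∈ (chartAt E x).source, P (extChartAt 𝓘(ℝ, E) x y)) :
    ∀ᶠ e in 𝓝 (extChartAt 𝓘(ℝ, E) x x), P e := by
  filter_upwards [extChartAt_target_mem_nhds (I := 𝓘(ℝ, E)) x] with e he
  rw [← (extChartAt 𝓘(ℝ, E) x).right_inv he]
  exact h _ (by simpa using (extChartAt 𝓘(ℝ, E) x).map_target he)

/-- A differential form, read in the chart at `x`. -/
def formInChart {F : Type*} [NormedAddCommGroup F] [NormedSpace ℝ F] {k : ℕ}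
    (η : Π y : M, TangentSpace 𝓘(ℝ, E) y [⋀^Fin k]→L[ℝ] F) (x : M) (e : E) : E [⋀^Fin k]→L[ℝ] F :=
  (η ((extChartAt 𝓘(ℝ, E) x).symm e)).compContinuousLinearMap
    (mfderiv 𝓘(ℝ, E) 𝓘(ℝ, E) (extChartAt 𝓘(ℝ, E) x).symm e)

theorem extDer_apply {F : Type*} [NormedAddCommGroup F] [NormedSpace ℝ F] {k : ℕ}
    (η : Π y : M, TangentSpace 𝓘(ℝ, E) y [⋀^Fin k]→L[ℝ] F) (x : M)
    (v : Fin (k + 1) → TangentSpace 𝓘(ℝ, E) x) :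
    extDer η x v = extDeriv (formInChart η x) (extChartAt 𝓘(ℝ, E) x x)
      fun i ↦ coframe x x (v i) := by
  rw [← mfderiv_extChartAt_eq_coframe (mem_chart_source E x)]
  rfl

theorem formInChart_apply {F : Type*} [NormedAddCommGroup F] [NormedSpace ℝ F] {k : ℕ}
    (η : Π y : M, TangentSpace 𝓘(ℝ, E) y [⋀^Fin k]→L[ℝ] F) {x y : M}
    (hy : y ∈ (chartAt E x).source) (v : Fin k → E) :
    formInChart η x (extChartAt 𝓘(ℝ, E) x y) v = η y fun i ↦ frame x y (v i) := by
  have hy' := (extChartAt 𝓘(ℝ, E) x).left_inv (by simpa using hy)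
  rw [formInChart, mfderiv_extChartAt_symm_eq_frame hy, hy']
  rfl

/-- The fundamental form of a Hermitian metric as a field of bilinear maps, read in the chart
at `x`. -/
def fundamentalFormInChart (J : ComplexStructure E M) (g : RiemMetric E M) (x : M) (e : E) :
    E →L[ℝ] E →L[ℝ] ℝ :=
  bilinInChart g.inner x e ∘L endoInChart J.toFun x e

theorem fundamentalFormInChart_apply (J : ComplexStructure E M) (g : RiemMetric E M) {x y : M}
    (hy : y ∈ (chartAt E x).source) (v w : E) :
    fundamentalFormInChart J g x (extChartAt 𝓘(ℝ, E) x y) v w =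
      g.inner y (J.toFun y (frame x y v)) (frame x y w) := by
  rw [← frame_endoInChart J.toFun hy]
  exact bilinInChart_apply g.inner hy _ _

theorem differentiableAt_fundamentalFormInChart (J : ComplexStructure E M) (g : RiemMetric E M)
    (x : M) :
    DifferentiableAt ℝ (fundamentalFormInChart J g x) (extChartAt 𝓘(ℝ, E) x x) :=
  (differentiableAt_bilinInChart g.contMDiff x).clm_comp (differentiableAt_endoInChart J.smooth x)

theorem formInChart_fundamentalForm (J : ComplexStructure E M) {g : RiemMetric E M}
    (hg : J.IsHermitian g) (x : M) :
    ∀ᶠ e in 𝓝 (extChartAt 𝓘(ℝ, E) x x), ∀ v,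
      formInChart (J.fundamentalForm hg) x e v = fundamentalFormInChart J g x e (v 0) (v 1) :=
  eventually_extChartAt x fun y hy v ↦ by
    rw [formInChart_apply _ hy, fundamentalFormInChart_apply J g hy]
    rfl

theorem HypercomplexStructure.isHypercomplexJet (h : HypercomplexStructure E M) (x : M) :
    IsHypercomplexJet (endoInChart h.I.toFun x (extChartAt 𝓘(ℝ, E) x x))
      (endoInChart h.J.toFun x (extChartAt 𝓘(ℝ, E) x x))
      (fderiv ℝ (endoInChart h.I.toFun x) (extChartAt 𝓘(ℝ, E) x x))
      (fderiv ℝ (endoInChart h.J.toFun x) (extChartAt 𝓘(ℝ, E) x x)) := by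
  have sq : ∀ A : ComplexStructure E M, ∀ᶠ e in 𝓝 (extChartAt 𝓘(ℝ, E) x x), ∀ v,
      endoInChart A.toFun x e (endoInChart A.toFun x e v) = -v := fun A ↦
    eventually_extChartAt x fun y hy v ↦ by
      rw [← coframe_frame hy (endoInChart A.toFun x _ _), frame_endoInChart _ hy,
        frame_endoInChart _ hy, A.sq_eq_neg, map_neg, coframe_frame hy]
  refine isHypercomplexJet_of_eventually (differentiableAt_endoInChart h.I.smooth x)
    (differentiableAt_endoInChart h.J.smooth x) (sq h.I) (sq h.J) ?_
    (h.I.nijenhuisJet_eq_zero x) (h.J.nijenhuisJet_eq_zero x)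
  refine eventually_extChartAt x fun y hy v ↦ ?_
  rw [← coframe_frame hy (endoInChart h.J.toFun x _ _), frame_endoInChart _ hy,
    frame_endoInChart _ hy, h.J_I, ← h.I_J, ← frame_endoInChart h.J.toFun hy,
    ← frame_endoInChart h.I.toFun hy, map_neg, coframe_frame hy]

theorem ComplexStructure.IsKahler.isKahlerJet {I : ComplexStructure E M} {g : RiemMetric E M}
    (hg : I.IsKahler g) (x : M) :
    IsKahlerJet (endoInChart I.toFun x (extChartAt 𝓘(ℝ, E) x x))
      (fderiv ℝ (endoInChart I.toFun x) (extChartAt 𝓘(ℝ, E) x x))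
      (fun v w ↦ fundamentalFormInChart I g x (extChartAt 𝓘(ℝ, E) x x) v w)
      (fun u v w ↦ fderiv ℝ (fundamentalFormInChart I g x) (extChartAt 𝓘(ℝ, E) x x) u v w) := by
  have hd := differentiableAt_fundamentalFormInChart I g x
  refine isKahlerJet_of_eventually (differentiableAt_endoInChart I.smooth x) hd
    (eventually_extChartAt x fun y hy v w ↦ ?_) (eventually_extChartAt x fun y hy v w ↦ ?_)
    fun u v w ↦ ?_
  · rw [fundamentalFormInChart_apply I g hy, fundamentalFormInChart_apply I g hy, ← hg.hermitian,
      I.sq_eq_neg, ContinuousLinearMap.map_neg₂, g.symm]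
  · rw [fundamentalFormInChart_apply I g hy, fundamentalFormInChart_apply I g hy,
      frame_endoInChart _ hy, frame_endoInChart _ hy, hg.hermitian, I.sq_eq_neg,
      ContinuousLinearMap.map_neg₂]
  · have h0 := congrArg (fun α ↦ α fun i ↦ frame x x (![u, v, w] i)) (hg.closed x)
    simp only [extDer_apply, coframe_frame (mem_chart_source E x)] at h0
    rw [extDeriv_eq_of_apply_eq hd (formInChart_fundamentalForm I hg.hermitian x)] at h0
    exact h0

/-- With `ω` the fundamental form of `g` on `(M, I)`, the fundamental form of the averaged metric on
`(M, J)` is `-(ω(IJ·, ·) + ω(·, IJ·)) / 2`. -/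
theorem fundamentalFormInChart_averagedMetric_J (h : HypercomplexStructure E M) {g : RiemMetric E M}
    (hg : h.I.IsHermitian g) (x : M) :
    ∀ᶠ e in 𝓝 (extChartAt 𝓘(ℝ, E) x x), ∀ v w,
      fundamentalFormInChart h.J (averagedMetric h.J g) x e v w = (-1 / 2 : ℝ) *
        (fundamentalFormInChart h.I g x e
          ((endoInChart h.I.toFun x e ∘L endoInChart h.J.toFun x e) v) w +
        fundamentalFormInChart h.I g x e v
          ((endoInChart h.I.toFun x e ∘L endoInChart h.J.toFun x e) w)) :=
  eventually_extChartAt x fun y hy v w ↦ by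
    simp only [fundamentalFormInChart_apply _ _ hy, ContinuousLinearMap.comp_apply,
      frame_endoInChart _ hy, averagedMetric_apply, h.J.sq_eq_neg, h.I.sq_eq_neg,
      ContinuousLinearMap.map_neg₂, hg y]
    ring

/-- With `ω` the fundamental form of `g` on `(M, I)`, the fundamental form of the averaged metric on
`(M, K)` is `(ω(J·, ·) + ω(·, J·)) / 2`. -/
theorem fundamentalFormInChart_averagedMetric_K (h : HypercomplexStructure E M) {g : RiemMetric E M}
    (x : M) :
    ∀ᶠ e in 𝓝 (extChartAt 𝓘(ℝ, E) x x), ∀ v w,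
      fundamentalFormInChart h.K (averagedMetric h.J g) x e v w = (1 / 2 : ℝ) *
        (fundamentalFormInChart h.I g x e (endoInChart h.J.toFun x e v) w +
        fundamentalFormInChart h.I g x e v (endoInChart h.J.toFun x e w)) :=
  eventually_extChartAt x fun y hy v w ↦ by
    have hJK : ∀ v, h.J.toFun y (h.I.toFun y (h.J.toFun y v)) = h.I.toFun y v := fun v ↦ by
      rw [h.J_I, ← h.I_J, h.J.sq_eq_neg, map_neg, neg_neg]
    simp only [fundamentalFormInChart_apply _ _ hy, frame_endoInChart _ hy, averagedMetric_apply,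
      ← h.I_J, hJK]

/-- Taking the `(k, 0)`-part is natural in complex linear maps. -/
theorem holPart_comp {k : ℕ} {V W : Type*} [NormedAddCommGroup V] [NormedSpace ℝ V]
    [NormedAddCommGroup W] [NormedSpace ℝ W] {A : V →L[ℝ] V} {B : W →L[ℝ] W} {T : V →L[ℝ] W}
    (hT : ∀ v, T (A v) = B (T v)) (α : W [⋀^Fin k]→L[ℝ] ℂ) :
    holPart A (α.compContinuousLinearMap T) = (holPart B α).compContinuousLinearMap T := by
  ext v
  change (1 / 2 : ℂ) ^ k * ∑ S : Finset (Fin k), (-Complex.I) ^ S.card * α (T ∘ applyOn A S v) =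
    (1 / 2 : ℂ) ^ k * ∑ S : Finset (Fin k), (-Complex.I) ^ S.card * α (applyOn B S (T ∘ v))
  have : ∀ S, T ∘ applyOn A S v = applyOn B S (T ∘ v) := fun S ↦ by
    ext i
    by_cases h : i ∈ S <;> simp [applyOn, h, hT]
  simp only [this]

/-- The exterior derivative at `x`, in the chart at `x`, of the form `ω(A·, ·) + ω(·, A·)`, where
`ω` is the fundamental form of `g` on `(M, I)`. -/
def dTwistInChart (I : ComplexStructure E M) (g : RiemMetric E M) (x : M) (A : E → E →L[ℝ] E) :
    E → E → E → ℝ :=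
  dTwistJet (fun v w ↦ fundamentalFormInChart I g x (extChartAt 𝓘(ℝ, E) x x) v w)
    (fun u v w ↦ fderiv ℝ (fundamentalFormInChart I g x) (extChartAt 𝓘(ℝ, E) x x) u v w)
    (A (extChartAt 𝓘(ℝ, E) x x)) (fderiv ℝ A (extChartAt 𝓘(ℝ, E) x x))

theorem ComplexStructure.IsKahler.mul_dTwistInChart_neg {I : ComplexStructure E M}
    {g : RiemMetric E M} (hg : I.IsKahler g) (x : M) (A : E → E →L[ℝ] E) (c : ℝ) (u v w : E) :
    c * dTwistInChart I g x A (-u) v w = -(c * dTwistInChart I g x A u v w) := by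
  rw [← mul_neg]
  exact congrArg (c * ·) ((hg.isKahlerJet x).dTwistJet_neg _ _ u v w)

theorem HypercomplexStructure.extDeriv_hktForm_averagedMetric (h : HypercomplexStructure E M)
    {g : RiemMetric E M} (hg : h.I.IsHermitian g)
    (hq : h.IsQuaternionicHermitian (averagedMetric h.J g)) (x : M) (v : Fin 3 → E) :
    extDeriv (formInChart (h.hktForm hq) x) (extChartAt 𝓘(ℝ, E) x x) v =
      (((-1 / 2 : ℝ) * dTwistInChart h.I g x
        (fun e ↦ endoInChart h.I.toFun x e ∘L endoInChart h.J.toFun x e) (v 0) (v 1) (v 2) : ℝ) : ℂ)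
      + Complex.I * (((1 / 2 : ℝ) * dTwistInChart h.I g x (endoInChart h.J.toFun x)
        (v 0) (v 1) (v 2) : ℝ) : ℂ) := by
  have dI := differentiableAt_endoInChart h.I.smooth x
  have dJ := differentiableAt_endoInChart h.J.smooth x
  have dω := differentiableAt_fundamentalFormInChart h.I g x
  have dωJ := differentiableAt_fundamentalFormInChart h.J (averagedMetric h.J g) x
  have dωK := differentiableAt_fundamentalFormInChart h.K (averagedMetric h.J g) x
  have fJ := formInChart_fundamentalForm h.J hq.J x
  have fK := formInChart_fundamentalForm h.K hq.K x
  rw [extDeriv_re_add_im (β := formInChart (h.J.fundamentalForm hq.J) x)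
    (γ := formInChart (h.K.fundamentalForm hq.K) x) (differentiableAt_of_apply_eq dωJ fJ)
    (differentiableAt_of_apply_eq dωK fK) (fun _ _ ↦ rfl),
    extDeriv_eq_dTwistJet (dI.clm_comp dJ) dω dωJ fJ
      (fundamentalFormInChart_averagedMetric_J h hg x),
    extDeriv_eq_dTwistJet dJ dω dωK fK (fundamentalFormInChart_averagedMetric_K h x)]
  rfl

/-- The `(3,0)`-part of `dΩ` vanishes in the chart at `x` by `IsKahlerJet.dTwistJet_identity`, hence
on `T_x M` since the chart intertwines `I` with its expression in the chart. -/
theorem HypercomplexStructure.isHKT_averagedMetric (h : HypercomplexStructure E M)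
    {g : RiemMetric E M} (hg : h.I.IsKahler g) : h.IsHKT (averagedMetric h.J g) := by
  have hq := h.isQuaternionicHermitian_averagedMetric hg.hermitian
  refine ⟨hq, fun x ↦ ?_⟩
  have dI := differentiableAt_endoInChart h.I.smooth x
  have dJ := differentiableAt_endoInChart h.J.smooth x
  have hol : holPart (endoInChart h.I.toFun x (extChartAt 𝓘(ℝ, E) x x))
      (extDeriv (formInChart (h.hktForm hq) x) (extChartAt 𝓘(ℝ, E) x x)) = 0 := by
    refine holPart_eq_zero_of_re (h.isHypercomplexJet x).I_I
      (β := fun u v w ↦ (-1 / 2 : ℝ) * dTwistInChart h.I g x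
        (fun e ↦ endoInChart h.I.toFun x e ∘L endoInChart h.J.toFun x e) u v w)
      (γ := fun u v w ↦ (1 / 2 : ℝ) * dTwistInChart h.I g x (endoInChart h.J.toFun x) u v w)
      (h.extDeriv_hktForm_averagedMetric hg.hermitian hq x)
      (hg.mul_dTwistInChart_neg x _ _) (hg.mul_dTwistInChart_neg x _ _) fun u v w ↦ ?_
    have := (hg.isKahlerJet x).dTwistJet_identity (h.isHypercomplexJet x)
      (fderiv_clm_comp_apply dI dJ) u v w
    unfold dTwistInChart
    linear_combination (1 / 2 : ℝ) * this
  have hco : ∀ v, coframe x x (h.I.toFun x v) =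
      endoInChart h.I.toFun x (extChartAt 𝓘(ℝ, E) x x) (coframe x x v) := fun v ↦ by
    rw [← coframe_frame (mem_chart_source E x) (endoInChart h.I.toFun x _ _),
      frame_endoInChart _ (mem_chart_source E x), frame_coframe (mem_chart_source E x)]
  have hext : extDer (h.hktForm hq) x =
      (extDeriv (formInChart (h.hktForm hq) x) (extChartAt 𝓘(ℝ, E) x x)).compContinuousLinearMap
        (coframe x x) := by
    ext v
    exact extDer_apply _ x v
  rw [ComplexStructure.del, hext]
  refine (holPart_comp (V := E) hco _).trans ?_
  rw [hol]
  rfl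

end

end HKT

theorem mainTheorem3 {E : Type*} [NormedAddCommGroup E] [NormedSpace ℝ E] [FiniteDimensional ℝ E]
    {M : Type*} [TopologicalSpace M] [ChartedSpace E M] [IsManifold 𝓘(ℝ, E) ∞ M]
    (h : HKT.HypercomplexStructure E M) (g : HKT.RiemMetric E M) (hg : h.I.IsKahler g) :
    ∃ g₁ : HKT.RiemMetric E M, h.IsHKT g₁ ∧ h.IsAverage g₁ g :=
  ⟨HKT.averagedMetric h.J g, h.isHKT_averagedMetric hg, h.isAverage_averagedMetric hg.hermitian⟩
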